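/- Let $(M,\omega)$ be a connected symplectic manifold without boundary and let $L\subset M$ be a closed (compact, without boundary) connected Lagrangian submanifold. A smooth family $\{L_t\}_{0\le t\le 1}$ of Lagrangian submanifolds of $M$ diffeomorphic to $L$ is an *exact path* if there is a smooth compactly supported function $H:[0,1]\times M\to\mathbb R$ generating a Hamiltonian isotopy $\psi_t$ ($\psi_0=\mathrm{id}$, $\frac{d}{dt}\psi_t=X_t\circ\psi_t$, $\omega(X_t,\cdot)=dH_t$) with $\psi_t(L_0)=L_t$ for all $t\in[0,1]$. Its *Hofer length* is $$\mathrm{Length}(\{L_t\})=\int_0^1\Bigl(\max_{p\in L_t}H(t,p)-\min_{p\in L_t}H(t,p)\Bigr)\,dt ,$$ which does not depend on the choice of $H$. A *lift* of $\{L_t\}$ is a smooth map $[0,1]\times L\to M$, $(t,x)\mapsto\iota_t(x)$, such that each $\iota_t$ is a Lagrangian embedding with $\iota_t(L)=L_t$. The path is *regular* if for a lift $\{\iota_t\}$ and every $t\in[0,1]$ the $1$-form $\omega(\frac{d}{dt}\iota_t,d\iota_t\,\cdot)$ on $L$ is not identically zero. Let $\mathcal L(M,\omega,L)$ be the set of all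 Lagrangian submanifolds of $M$ connected to $L$ by an exact path. Let $\{L_t\}_{0\le t\le1}\subset\mathcal L(M,\omega,L)$ be a regular exact path and $I\subset\mathbb R$ an open interval containing $0$. An *exact variation* of $\{L_t\}$ is a smooth family $\iota_{s,t}$, $(s,t)\in I\times[0,1]$, of Lagrangian embeddings of $L$ into $M$ for which there is a lift $\{\iota_t\}$ of $\{L_t\}$ such that (i) $\iota_{0,t}=\iota_t$ for all $t\in[0,1]$; (ii) $\iota_{s,0}=\iota_0$ and $\iota_{s,1}=\iota_1$ for all $s\in I$; (iii) for each $s\in I$, $\{\iota_{s,t}\}_{0\le t\le1}$ is a lift of an exact path. Its *length function* is $$l(s)=\mathrm{Length}(\{\iota_{s,t}(L)\}_{0\le t\le1}),\qquad s\in I .$$ Then for every length function $l$ of an exact variation of $\{L_t\}$ there exist a convex function $u:\mathbb R\to\mathbb R$ and constants $\delta>0$, $C>0$ such that $(-\delta,\delta)\subset I$ and $$|l(s)-u(s)|\le C s^2\qquad\text{for all } s\in(-\delta,\delta).$$ -/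

import Mathlib

open Set
open scoped Manifold ContDiff

noncomputable section

namespace HoferLagrangian

section Ambient

/- `M` is a smooth manifold without boundary, modelled on the real vector space `E`. -/
variable {E : Type*} [NormedAddCommGroup E] [NormedSpace ℝ E]
  {M : Type*} [TopologicalSpace M] [ChartedSpace E M] [IsManifold 𝓘(ℝ, E) ∞ M]

/-- The expression in the chart of `M` at `x₀` of a field `Ω` of bilinear forms: the pull-back
of `Ω` by the inverse of the chart. -/
def chartForm (Ω : ∀ x : M, TangentSpace 𝓘(ℝ, E) x →L[ℝ] TangentSpace 𝓘(ℝ, E) x →L[ℝ] ℝ)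
    (x₀ : M) (y : E) : E →L[ℝ] E →L[ℝ] ℝ :=
  let B : E →L[ℝ] E →L[ℝ] ℝ := Ω ((chartAt E x₀).symm y)
  let A : E →L[ℝ] E := mfderiv 𝓘(ℝ, E) 𝓘(ℝ, E) (chartAt E x₀).symm y
  B.bilinearComp A A

/-- `Ω` is a symplectic form on `M`: a smooth, alternating, nondegenerate and closed field of
bilinear forms on the tangent spaces. -/
structure IsSymplecticForm
    (Ω : ∀ x : M, TangentSpace 𝓘(ℝ, E) x →L[ℝ] TangentSpace 𝓘(ℝ, E) x →L[ℝ] ℝ) : Prop where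
  smooth : ContMDiff 𝓘(ℝ, E) (𝓘(ℝ, E).prod 𝓘(ℝ, E →L[ℝ] E →L[ℝ] ℝ)) ∞
    (fun x => Bundle.TotalSpace.mk' (E →L[ℝ] E →L[ℝ] ℝ)
      (E := fun x : M => TangentSpace 𝓘(ℝ, E) x →L[ℝ] TangentSpace 𝓘(ℝ, E) x →L[ℝ] ℝ) x (Ω x))
  alternating : ∀ (x : M) (v : TangentSpace 𝓘(ℝ, E) x), Ω x v v = 0
  nondegenerate : ∀ (x : M) (v : TangentSpace 𝓘(ℝ, E) x), (∀ w, Ω x v w = 0) → v = 0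
  /-- In every chart the exterior derivative `dΩ(u, v, w)`, i.e. the cyclic sum of the
  derivatives of the coefficients, vanishes. -/
  closed : ∀ (x₀ : M), ∀ y ∈ (chartAt E x₀).target, ∀ u v w : E,
    fderiv ℝ (chartForm Ω x₀) y u v w + fderiv ℝ (chartForm Ω x₀) y v w u
      + fderiv ℝ (chartForm Ω x₀) y w u v = 0

/-- The velocity at time `t ∈ [0,1]` of a curve `γ : [0,1] → M` (one-sided at the ends). -/
def velocity (γ : ℝ → M) (t : ℝ) : TangentSpace 𝓘(ℝ, E) (γ t) :=
  mfderivWithin 𝓘(ℝ, ℝ) 𝓘(ℝ, E) γ (Icc 0 1) t (1 : ℝ)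

/-- `X` is the Hamiltonian vector field of the function `f`, with the sign convention
`Ω(X, ·) = df`. -/
def IsHamiltonianField
    (Ω : ∀ x : M, TangentSpace 𝓘(ℝ, E) x →L[ℝ] TangentSpace 𝓘(ℝ, E) x →L[ℝ] ℝ)
    (f : M → ℝ) (X : ∀ x : M, TangentSpace 𝓘(ℝ, E) x) : Prop :=
  ∀ (x : M) (v : TangentSpace 𝓘(ℝ, E) x), Ω x (X x) v = mfderiv 𝓘(ℝ, E) 𝓘(ℝ, ℝ) f x v

/-- `ψ` is the Hamiltonian isotopy of `M`, `t ∈ [0,1]`, that is generated by the smooth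
compactly supported Hamiltonian function `H : [0,1] × M → ℝ`:
`ψ₀ = id` and `dψ_t/dt = X_t ∘ ψ_t`, where `Ω(X_t, ·) = dH_t`. -/
structure IsHamiltonianIsotopy
    (Ω : ∀ x : M, TangentSpace 𝓘(ℝ, E) x →L[ℝ] TangentSpace 𝓘(ℝ, E) x →L[ℝ] ℝ)
    (H : ℝ → M → ℝ) (ψ : ℝ → Diffeomorph 𝓘(ℝ, E) 𝓘(ℝ, E) M M ∞) : Prop where
  smooth_hamiltonian : ContMDiffOn (𝓘(ℝ, ℝ).prod 𝓘(ℝ, E)) 𝓘(ℝ, ℝ) ∞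
    (fun p : ℝ × M => H p.1 p.2) (Icc 0 1 ×ˢ univ)
  compact_support : ∃ K : Set M, IsCompact K ∧ ∀ t ∈ Icc (0 : ℝ) 1, ∀ x ∉ K, H t x = 0
  smooth : ContMDiffOn (𝓘(ℝ, ℝ).prod 𝓘(ℝ, E)) 𝓘(ℝ, E) ∞
    (fun p : ℝ × M => ψ p.1 p.2) (Icc 0 1 ×ˢ univ)
  smooth_inverse : ContMDiffOn (𝓘(ℝ, ℝ).prod 𝓘(ℝ, E)) 𝓘(ℝ, E) ∞
    (fun p : ℝ × M => (ψ p.1).symm p.2) (Icc 0 1 ×ˢ univ)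
  start : ∀ x, ψ 0 x = x
  flow : ∃ X : ℝ → ∀ x : M, TangentSpace 𝓘(ℝ, E) x, ∀ t ∈ Icc (0 : ℝ) 1,
    IsHamiltonianField Ω (H t) (X t) ∧
      ∀ x, velocity (fun τ => ψ τ x) t = X t (ψ t x)

/-- `ℓ` is the Hofer length `∫₀¹ (max_{L_t} H_t - min_{L_t} H_t) dt` of the exact path
`{L_t}` (written `Λ t`), where `H` is a compactly supported Hamiltonian function generating a
Hamiltonian isotopy `ψ_t` with `ψ_t(L_0) = L_t`. (For closed connected Lagrangian submanifolds
`L_t` the number does not depend on the choice of `H`.) -/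
def IsHoferLength
    (Ω : ∀ x : M, TangentSpace 𝓘(ℝ, E) x →L[ℝ] TangentSpace 𝓘(ℝ, E) x →L[ℝ] ℝ)
    (Λ : ℝ → Set M) (ℓ : ℝ) : Prop :=
  ∃ (H : ℝ → M → ℝ) (ψ : ℝ → Diffeomorph 𝓘(ℝ, E) 𝓘(ℝ, E) M M ∞),
    IsHamiltonianIsotopy Ω H ψ ∧ (∀ t ∈ Icc (0 : ℝ) 1, ψ t '' Λ 0 = Λ t) ∧
      ℓ = ∫ t in (0 : ℝ)..1, (sSup (H t '' Λ t) - sInf (H t '' Λ t))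

end Ambient

section Lagrangian

/- `L` is a manifold modelled on `F`; `M` is a manifold modelled on `E`. -/
variable {E : Type*} [NormedAddCommGroup E] [NormedSpace ℝ E]
  {M : Type*} [TopologicalSpace M] [ChartedSpace E M] [IsManifold 𝓘(ℝ, E) ∞ M]

/-- `ι : L → M` is a Lagrangian embedding: a smooth embedding with `ι^*Ω = 0`, where
`dim M = 2 dim L`. -/
structure IsLagrangianEmbedding
    {F : Type*} [NormedAddCommGroup F] [NormedSpace ℝ F]
    {L : Type*} [TopologicalSpace L] [ChartedSpace F L]
    (Ω : ∀ x : M, TangentSpace 𝓘(ℝ, E) x →L[ℝ] TangentSpace 𝓘(ℝ, E) x →L[ℝ] ℝ)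
    (ι : L → M) : Prop where
  embedding : Manifold.IsSmoothEmbedding 𝓘(ℝ, F) 𝓘(ℝ, E) ∞ ι
  isotropic : ∀ (x : L) (v w : TangentSpace 𝓘(ℝ, F) x),
    Ω (ι x) (mfderiv 𝓘(ℝ, F) 𝓘(ℝ, E) ι x v) (mfderiv 𝓘(ℝ, F) 𝓘(ℝ, E) ι x w) = 0
  dim : Module.finrank ℝ E = 2 * Module.finrank ℝ F

/-- `ι` is a lift of the path `{L_t}`, `t ∈ [0,1]` (written `Λ t`), of Lagrangian submanifolds of
`M`: a smooth map `[0,1] × L → M` such that every `ι_t` is a Lagrangian embedding with image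
`L_t`. -/
structure IsLift
    {F : Type*} [NormedAddCommGroup F] [NormedSpace ℝ F]
    {L : Type*} [TopologicalSpace L] [ChartedSpace F L]
    (Ω : ∀ x : M, TangentSpace 𝓘(ℝ, E) x →L[ℝ] TangentSpace 𝓘(ℝ, E) x →L[ℝ] ℝ)
    (Λ : ℝ → Set M) (ι : ℝ → L → M) : Prop where
  smooth : ContMDiffOn (𝓘(ℝ, ℝ).prod 𝓘(ℝ, F)) 𝓘(ℝ, E) ∞
    (fun p : ℝ × L => ι p.1 p.2) (Icc 0 1 ×ˢ univ)
  lagrangian : ∀ t ∈ Icc (0 : ℝ) 1, IsLagrangianEmbedding (F := F) Ω (ι t)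
  range_eq : ∀ t ∈ Icc (0 : ℝ) 1, range (ι t) = Λ t

variable (F : Type*) [NormedAddCommGroup F] [NormedSpace ℝ F]
  (L : Type*) [TopologicalSpace L] [ChartedSpace F L]
  (Ω : ∀ x : M, TangentSpace 𝓘(ℝ, E) x →L[ℝ] TangentSpace 𝓘(ℝ, E) x →L[ℝ] ℝ)

/-- `{L_t}`, `t ∈ [0,1]`, is an exact Lagrangian path: a smooth path of Lagrangian submanifolds
diffeomorphic to `L` such that `ψ_t(L_0) = L_t` for some Hamiltonian isotopy `ψ_t` of `M`. -/
def IsExactPath (Λ : ℝ → Set M) : Prop :=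
  (∃ ι : ℝ → L → M, IsLift (F := F) Ω Λ ι) ∧
    ∃ (H : ℝ → M → ℝ) (ψ : ℝ → Diffeomorph 𝓘(ℝ, E) 𝓘(ℝ, E) M M ∞),
      IsHamiltonianIsotopy Ω H ψ ∧ ∀ t ∈ Icc (0 : ℝ) 1, ψ t '' Λ 0 = Λ t

/-- The space `𝓛(M, Ω, L)` of all Lagrangian submanifolds of `M` that are connected by an exact
path to the Lagrangian submanifold `K = j(L)` of `M`. -/
def exactClass (K : Set M) : Set (Set M) :=
  {K' | ∃ Λ : ℝ → Set M, IsExactPath F L Ω Λ ∧ Λ 0 = K ∧ Λ 1 = K'}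

/-- The path `{L_t}` is regular: its velocity `dL_t/dt`, the `1`-form
`α_t = Ω(dι_t/dt, dι_t ·)` for a lift `ι` of the path, is nonzero for every `t ∈ [0,1]`. -/
def IsRegularPath (Λ : ℝ → Set M) : Prop :=
  ∃ ι : ℝ → L → M, IsLift (F := F) Ω Λ ι ∧
    ∀ t ∈ Icc (0 : ℝ) 1, ∃ (x : L) (v : TangentSpace 𝓘(ℝ, F) x),
      Ω (ι t x) (velocity (fun τ => ι τ x) t) (mfderiv 𝓘(ℝ, F) 𝓘(ℝ, E) (ι t) x v) ≠ 0

/-- `Φ` is an exact variation, with parameter `s ∈ I`, of the path `{L_t}`, `t ∈ [0,1]`: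
a smooth family `Φ s t = ι_{s,t}` of Lagrangian embeddings of `L` for which there is a lift `ι`
of `{L_t}` such that `ι_{0,t} = ι_t`, the ends `ι_{s,0} = ι_0` and `ι_{s,1} = ι_1` are fixed, and
for each `s` the family `ι_{s,t}` is a lift of an exact path. -/
structure IsExactVariation (Λ : ℝ → Set M) (I : Set ℝ) (Φ : ℝ → ℝ → L → M) : Prop where
  smooth : ContMDiffOn (𝓘(ℝ, ℝ).prod (𝓘(ℝ, ℝ).prod 𝓘(ℝ, F))) 𝓘(ℝ, E) ∞
    (fun p : ℝ × ℝ × L => Φ p.1 p.2.1 p.2.2) (I ×ˢ Icc 0 1 ×ˢ univ)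
  lagrangian : ∀ s ∈ I, ∀ t ∈ Icc (0 : ℝ) 1, IsLagrangianEmbedding (F := F) Ω (Φ s t)
  exists_lift : ∃ ι : ℝ → L → M, IsLift (F := F) Ω Λ ι ∧
    (∀ t ∈ Icc (0 : ℝ) 1, Φ 0 t = ι t) ∧
    (∀ s ∈ I, Φ s 0 = ι 0 ∧ Φ s 1 = ι 1) ∧
    (∀ s ∈ I, ∃ Λ' : ℝ → Set M, IsExactPath F L Ω Λ' ∧ IsLift (F := F) Ω Λ' (Φ s))

end Lagrangian

/-- `l` is the length function of the variation `Φ` with parameter `s ∈ I`: for each `s ∈ I`,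
`l(s)` is the Hofer length of the path `{ι_{s,t}(L)}`, where `ι_{s,t} = Φ s t`. -/
def IsLengthFunction
    {E : Type*} [NormedAddCommGroup E] [NormedSpace ℝ E]
    {M : Type*} [TopologicalSpace M] [ChartedSpace E M] [IsManifold 𝓘(ℝ, E) ∞ M]
    {L : Type*}
    (Ω : ∀ x : M, TangentSpace 𝓘(ℝ, E) x →L[ℝ] TangentSpace 𝓘(ℝ, E) x →L[ℝ] ℝ)
    (I : Set ℝ) (Φ : ℝ → ℝ → L → M) (l : ℝ → ℝ) : Prop :=
  ∀ s ∈ I, IsHoferLength Ω (fun t => range (Φ s t)) (l s)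

end HoferLagrangian

end

/-! ### Semiconvexity of oscillations and of their integrals -/

section Analysis

/-! The Hamiltonians `H s` may be chosen with no regularity in `s`, but only their restrictions to
the Lagrangians matter. Put `k s t x = H s t (Φ s t x)`. For `0 < t < 1` the differential of `k s t`
on `L` is the velocity form `Ω(∂ₜΦ, dΦ ·)` (`velocity_form_eq_mfderiv_hamiltonian`): the velocity
differs from the Hamiltonian field by a vector tangent to the Lagrangian, and `Ω` kills that vector
against other tangent vectors. This form is smooth in `(s, t, x)` whatever the choice of `H`.

Hence the differences `k s t x - k s t y`, which are free of the additive constants in `H`, behave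
like C² functions of `s`: their deviation from affine interpolation is at most `C p q (a - b)²`.
This is proved in charts (`exists_almostAffineOn_hamiltonian_local`) and made uniform in `t`, `x`,
`y` by compactness and connectedness (`exists_almostAffineOn_sub_of_local`).

The oscillation of `k s t` is the maximum of these differences over pairs `(x, y)`. A maximum of
almost affine functions is convex up to the same error, and so is its integral over `t`. Since `s²`
deviates from affine interpolation by exactly `p q (a - b)²`, adding a large multiple of `s²` to `l`
makes it convex near `0`; a convex extension of that sum to the line is `u`. -/

/-- `f` deviates from affine interpolation on `S` by at most `C` times the deviation of `s ↦ s²`. -/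
def AlmostAffineOn {G : Type*} [NormedAddCommGroup G] [NormedSpace ℝ G]
    (S : Set ℝ) (C : ℝ) (f : ℝ → G) : Prop :=
  ∀ ⦃a⦄, a ∈ S → ∀ ⦃b⦄, b ∈ S → ∀ ⦃p q : ℝ⦄, 0 ≤ p → 0 ≤ q → p + q = 1 →
    ‖f (p * a + q * b) - p • f a - q • f b‖ ≤ C * (p * q * (a - b) ^ 2)

namespace AlmostAffineOn

variable {G : Type*} [NormedAddCommGroup G] [NormedSpace ℝ G] {S T : Set ℝ} {C D : ℝ}
  {f g : ℝ → G}

theorem mono (h : AlmostAffineOn S C f) (hT : T ⊆ S) (hD : C ≤ D) : AlmostAffineOn T D f :=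
  fun _ ha _ hb _ _ hp hq hpq => (h (hT ha) (hT hb) hp hq hpq).trans
    (mul_le_mul_of_nonneg_right hD (mul_nonneg (mul_nonneg hp hq) (sq_nonneg _)))

theorem add (hf : AlmostAffineOn S C f) (hg : AlmostAffineOn S D g) :
    AlmostAffineOn S (C + D) (fun s => f s + g s) := by
  intro a ha b hb p q hp hq hpq
  have e : f (p * a + q * b) + g (p * a + q * b) - p • (f a + g a) - q • (f b + g b)
      = (f (p * a + q * b) - p • f a - q • f b) + (g (p * a + q * b) - p • g a - q • g b) := by
    simp only [smul_add]; abel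
  rw [e, add_mul]
  exact (norm_add_le _ _).trans (add_le_add (hf ha hb hp hq hpq) (hg ha hb hp hq hpq))

theorem neg (hf : AlmostAffineOn S C f) : AlmostAffineOn S C (fun s => -f s) := by
  intro a ha b hb p q hp hq hpq
  have e : -f (p * a + q * b) - p • (-f a) - q • (-f b)
      = -(f (p * a + q * b) - p • f a - q • f b) := by
    simp only [smul_neg]; abel
  rw [e, norm_neg]
  exact hf ha hb hp hq hpq

/-- A function whose derivative is Lipschitz is almost affine. -/
theorem of_hasDerivWithinAt {K : NNReal} {f' : ℝ → G} (hS : Convex ℝ S)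
    (hf : ∀ s ∈ S, HasDerivWithinAt f (f' s) S s) (hL : LipschitzOnWith K f' S) :
    AlmostAffineOn S K f := by
  -- Mean value inequality for `f` minus its tangent at `m`: on the segment the derivative of this
  -- difference is at most `K |s - m|`.
  have taylor : ∀ m ∈ S, ∀ s ∈ S, ‖f s - f m - (s - m) • f' m‖ ≤ K * (s - m) ^ 2 := by
    intro m hm s hs
    have hsub : segment ℝ m s ⊆ S := hS.segment_subset hm hs
    have key := (convex_segment m s).norm_image_sub_le_of_norm_hasDerivWithin_le
      (f := fun r => f r - (r - m) • f' m) (f' := fun r => f' r - f' m) (C := K * |s - m|)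
      (x := m) (y := s)
      (fun r hr => by
        have h1 := (hf r (hsub hr)).mono hsub
        have h2 : HasDerivWithinAt (fun r : ℝ => (r - m) • f' m) ((1 : ℝ) • f' m)
            (segment ℝ m s) r :=
          ((hasDerivWithinAt_id r _).sub_const m).smul_const (f' m)
        rw [one_smul] at h2
        exact h1.sub h2)
      (fun r hr => by
        have h1 := hL.dist_le_mul r (hsub hr) m hm
        rw [dist_eq_norm, Real.dist_eq] at h1
        refine h1.trans (mul_le_mul_of_nonneg_left ?_ K.2)
        rw [segment_eq_uIcc] at hr
        exact (Set.abs_sub_left_of_mem_uIcc hr))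
      (left_mem_segment ℝ m s) (right_mem_segment ℝ m s)
    simp only [sub_self, zero_smul, sub_zero, Real.norm_eq_abs] at key
    rw [mul_assoc, abs_mul_abs_self, ← pow_two] at key
    rwa [sub_right_comm]
  intro a ha b hb p q hp hq hpq
  have hm : p * a + q * b ∈ S := hS ha hb hp hq hpq
  set m := p * a + q * b with hmdef
  have e1 : a - m = q * (a - b) := by rw [hmdef]; linear_combination a * hpq.symm
  have e2 : b - m = -(p * (a - b)) := by rw [hmdef]; linear_combination b * hpq.symm
  have t1 := taylor m hm a ha
  have t2 := taylor m hm b hb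
  -- The linear terms cancel because `p (a - m) + q (b - m) = 0`. The two remainders carry the
  -- weights `p q²` and `q p²`, which add up to `p q`.
  have e : f m - p • f a - q • f b
      = -(p • (f a - f m - (a - m) • f' m) + q • (f b - f m - (b - m) • f' m)) := by
    rw [e1, e2]
    have hq' : q = 1 - p := by linarith
    subst hq'
    module
  rw [e, norm_neg]
  refine (norm_add_le _ _).trans ?_
  rw [norm_smul, norm_smul, Real.norm_of_nonneg hp, Real.norm_of_nonneg hq]
  have u1 := mul_le_mul_of_nonneg_left t1 hp
  have u2 := mul_le_mul_of_nonneg_left t2 hq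
  refine (add_le_add u1 u2).trans (le_of_eq ?_)
  rw [e1, e2]
  linear_combination (K * p * q * (a - b) ^ 2 : ℝ) * hpq

end AlmostAffineOn

/-- A convex function on an interval around `0` agrees near `0` with a convex function on `ℝ`. -/
theorem ConvexOn.exists_convexOn_univ_eqOn {f : ℝ → ℝ} {δ : ℝ} (hδ : 0 < δ)
    (hf : ConvexOn ℝ (Ioo (-δ) δ) f) :
    ∃ u : ℝ → ℝ, ConvexOn ℝ univ u ∧ ∃ r, 0 < r ∧ r ≤ δ ∧ EqOn u f (Ioo (-r) r) := by
  have h0 : (0 : ℝ) ∈ Ioo (-δ) δ := ⟨by linarith, hδ⟩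
  obtain ⟨K, t, ht, hK⟩ := hf.locallyLipschitzOn isOpen_Ioo h0
  rw [isOpen_Ioo.nhdsWithin_eq h0] at ht
  obtain ⟨ε, hε, hεt⟩ := Metric.mem_nhds_iff.1 ht
  set r := min ε δ with hr
  have hr0 : 0 < r := lt_min hε hδ
  set S := Ioo (-r) r with hS
  have hSt : S ⊆ t := fun x hx => hεt (by
    rw [Metric.mem_ball, dist_zero_right, Real.norm_eq_abs, abs_lt]
    exact ⟨by linarith [hx.1, min_le_left ε δ], by linarith [hx.2, min_le_left ε δ]⟩)
  have hSδ : S ⊆ Ioo (-δ) δ := Ioo_subset_Ioo (by linarith [min_le_right ε δ]) (min_le_right _ _)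
  have hL : ∀ x ∈ S, ∀ y ∈ S, f x ≤ f y + K * |x - y| := by
    intro x hx y hy
    have h := hK.dist_le_mul x (hSt hx) y (hSt hy)
    rw [Real.dist_eq, Real.dist_eq] at h
    linarith [le_abs_self (f x - f y)]
  have h0S : (0 : ℝ) ∈ S := ⟨by linarith, hr0⟩
  have : Nonempty S := ⟨⟨0, h0S⟩⟩
  -- The extension is the infimal convolution of `f` on `S` with `K |·|`. It is convex as the
  -- partial infimum of a jointly convex function, and it equals `f` on `S` because `f` is
  -- `K`-Lipschitz there.
  set g : ℝ → S → ℝ := fun x y => f y + K * |x - y| with hg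
  have hbdd : ∀ x, BddBelow (range (g x)) := by
    intro x
    refine ⟨f 0 - K * |x|, ?_⟩
    rintro _ ⟨y, rfl⟩
    have h1 := hL 0 h0S y y.2
    have h2 : |0 - (y : ℝ)| ≤ |x| + |x - y| := by
      have := abs_sub_abs_le_abs_sub (y : ℝ) x
      rw [zero_sub, abs_neg, abs_sub_comm x]; linarith
    have h3 := mul_le_mul_of_nonneg_left h2 K.2
    simp only [hg]
    change (K : ℝ) * _ ≤ K * _ at h3
    linarith
  refine ⟨fun x => ⨅ y, g x y, ⟨convex_univ, ?_⟩, r, hr0, min_le_right _ _, ?_⟩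
  · intro x _ y _ a b ha hb hab
    -- `S` is open, so the infima need not be attained; points within `e` of them suffice.
    refine le_of_forall_pos_le_add fun e he => ?_
    obtain ⟨x', hx'⟩ := exists_lt_of_ciInf_lt (lt_add_of_pos_right (⨅ z, g x z) he)
    obtain ⟨y', hy'⟩ := exists_lt_of_ciInf_lt (lt_add_of_pos_right (⨅ z, g y z) he)
    have hz : a * (x' : ℝ) + b * y' ∈ S := (convex_Ioo _ _) x'.2 y'.2 ha hb hab
    have h1 := ciInf_le (hbdd (a • x + b • y)) ⟨_, hz⟩
    have h2 := hf.2 (hSδ x'.2) (hSδ y'.2) ha hb hab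
    simp only [smul_eq_mul, hg] at h1 h2 hx' hy' ⊢
    have h3 : |a * x + b * y - (a * x' + b * y')| ≤ a * |x - x'| + b * |y - y'| := by
      have : a * x + b * y - (a * x' + b * y') = a * (x - x') + b * (y - y') := by ring
      rw [this]
      refine (abs_add_le _ _).trans ?_
      rw [abs_mul, abs_mul, abs_of_nonneg ha, abs_of_nonneg hb]
    have h4 := mul_le_mul_of_nonneg_left h3 K.coe_nonneg
    have h5 := mul_le_mul_of_nonneg_left hx'.le ha
    have h6 := mul_le_mul_of_nonneg_left hy'.le hb
    have h7 : a * e + b * e = e := by rw [← add_mul, hab, one_mul]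
    linarith
  · intro x hx
    refine le_antisymm ?_ (le_ciInf fun y => hL x hx y y.2)
    have := ciInf_le (hbdd x) ⟨x, hx⟩
    simpa [hg] using this

/-- A function that is convex near `0` up to a quadratic error is at quadratic distance from a
convex function. -/
theorem exists_convexOn_abs_sub_le_sq {l : ℝ → ℝ} {δ C : ℝ} (hδ : 0 < δ)
    (h : ∀ a ∈ Ioo (-δ) δ, ∀ b ∈ Ioo (-δ) δ, ∀ p q : ℝ, 0 ≤ p → 0 ≤ q → p + q = 1 →
      l (p * a + q * b) ≤ p * l a + q * l b + C * (p * q * (a - b) ^ 2)) :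
    ∃ (u : ℝ → ℝ) (r D : ℝ), ConvexOn ℝ univ u ∧ 0 < r ∧ r ≤ δ ∧ 0 < D ∧
      ∀ s : ℝ, |s| < r → |l s - u s| ≤ D * s ^ 2 := by
  -- The deviation of `s²` from affine interpolation is exactly `p q (a - b)²`, so `C s²` absorbs
  -- the error. Taking `max C 1` makes the final constant positive.
  have hconv : ConvexOn ℝ (Ioo (-δ) δ) (fun s => l s + max C 1 * s ^ 2) := by
    refine ⟨convex_Ioo _ _, fun a ha b hb p q hp hq hpq => ?_⟩
    have h1 := h a ha b hb p q hp hq hpq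
    have h2 := mul_le_mul_of_nonneg_right (le_max_left C 1)
      (mul_nonneg (mul_nonneg hp hq) (sq_nonneg (a - b)))
    simp only [smul_eq_mul]
    have hq' : q = 1 - p := by linarith
    subst hq'
    nlinarith
  obtain ⟨u, hu, r, hr, hrδ, he⟩ := hconv.exists_convexOn_univ_eqOn hδ
  refine ⟨u, r, max C 1, hu, hr, hrδ, by positivity, fun s hs => ?_⟩
  rw [he (abs_lt.1 hs)]
  have : l s - (l s + max C 1 * s ^ 2) = -(max C 1 * s ^ 2) := by ring
  rw [this, abs_neg, abs_of_nonneg (by positivity)]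

/-- The maximum minus the minimum is convex up to a quadratic error if all differences of values
are almost affine. -/
theorem sSup_sub_sInf_range_le {L : Type*} [TopologicalSpace L] [CompactSpace L] [Nonempty L]
    {k : ℝ → L → ℝ} {S : Set ℝ} {C : ℝ} (hS : Convex ℝ S) (hk : ∀ s ∈ S, Continuous (k s))
    (h : ∀ x y, AlmostAffineOn S C (fun s => k s x - k s y))
    {a b p q : ℝ} (ha : a ∈ S) (hb : b ∈ S) (hp : 0 ≤ p) (hq : 0 ≤ q) (hpq : p + q = 1) :
    sSup (range (k (p * a + q * b))) - sInf (range (k (p * a + q * b)))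
      ≤ p * (sSup (range (k a)) - sInf (range (k a)))
        + q * (sSup (range (k b)) - sInf (range (k b))) + C * (p * q * (a - b) ^ 2) := by
  have hm : p * a + q * b ∈ S := hS ha hb hp hq hpq
  have hc : ∀ s ∈ S, IsCompact (range (k s)) := fun s hs => isCompact_range (hk s hs)
  -- The extremal points at the intermediate parameter also serve as competitors at `a` and `b`.
  obtain ⟨x, hx⟩ := (hc _ hm).sSup_mem (range_nonempty _)
  obtain ⟨y, hy⟩ := (hc _ hm).sInf_mem (range_nonempty _)
  have h1 := (abs_le.1 (h x y ha hb hp hq hpq)).2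
  have osc : ∀ s ∈ S, k s x - k s y ≤ sSup (range (k s)) - sInf (range (k s)) := fun s hs =>
    sub_le_sub (le_csSup (hc s hs).bddAbove ⟨x, rfl⟩) (csInf_le (hc s hs).bddBelow ⟨y, rfl⟩)
  have h2 := mul_le_mul_of_nonneg_left (osc a ha) hp
  have h3 := mul_le_mul_of_nonneg_left (osc b hb) hq
  rw [← hx, ← hy]
  simp only [smul_eq_mul] at h1
  linarith

/-- Compactness of `L` makes extrema depend continuously on `t`. This supplies the integrability
needed to split and compare the length integrals. -/
theorem continuousOn_sSup_sub_sInf_range {L : Type*} [TopologicalSpace L] [CompactSpace L]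
    {k : ℝ → L → ℝ} {T : Set ℝ} (hk : ContinuousOn (fun p : ℝ × L => k p.1 p.2) (T ×ˢ univ)) :
    ContinuousOn (fun t => sSup (range (k t)) - sInf (range (k t))) T := by
  rw [continuousOn_iff_continuous_domRestrict]
  have hc : Continuous ↿(fun (t : T) (x : L) => k t x) :=
    hk.comp_continuous (f := fun p : T × L => ((p.1 : ℝ), p.2)) (by fun_prop)
      (fun p => ⟨p.1.2, mem_univ _⟩)
  have h1 := isCompact_univ.continuous_sSup hc
  have h2 := isCompact_univ.continuous_sInf hc
  simp only [image_univ] at h1 h2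
  exact h1.sub h2

/-- An integral of oscillations of functions whose differences are uniformly almost affine in the
parameter is at quadratic distance from a convex function. -/
theorem exists_convexOn_abs_integral_osc_sub_le_sq
    {L : Type*} [TopologicalSpace L] [CompactSpace L] [Nonempty L]
    {k : ℝ → ℝ → L → ℝ} {l : ℝ → ℝ} {δ C : ℝ} (hδ : 0 < δ)
    (hk : ∀ s ∈ Ioo (-δ) δ, ContinuousOn (fun p : ℝ × L => k s p.1 p.2) (Icc 0 1 ×ˢ univ))
    (hl : ∀ s ∈ Ioo (-δ) δ,
      l s = ∫ t in (0 : ℝ)..1, (sSup (range (k s t)) - sInf (range (k s t))))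
    (h : ∀ t ∈ Ioo (0 : ℝ) 1, ∀ x y,
      AlmostAffineOn (Ioo (-δ) δ) C (fun s => k s t x - k s t y)) :
    ∃ (u : ℝ → ℝ) (r D : ℝ), ConvexOn ℝ univ u ∧ 0 < r ∧ r ≤ δ ∧ 0 < D ∧
      ∀ s : ℝ, |s| < r → |l s - u s| ≤ D * s ^ 2 := by
  refine exists_convexOn_abs_sub_le_sq (C := C) hδ fun a ha b hb p q hp hq hpq => ?_
  have hm : p * a + q * b ∈ Ioo (-δ) δ := convex_Ioo _ _ ha hb hp hq hpq
  have hint : ∀ s ∈ Ioo (-δ) δ, IntervalIntegrable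
      (fun t => sSup (range (k s t)) - sInf (range (k s t))) MeasureTheory.volume 0 1 := by
    intro s hs
    refine ContinuousOn.intervalIntegrable ?_
    rw [uIcc_of_le zero_le_one]
    exact continuousOn_sSup_sub_sInf_range (hk s hs)
  rw [hl _ hm, hl _ ha, hl _ hb]
  have i1 := (hint a ha).const_mul p
  have i2 := (hint b hb).const_mul q
  have i3 : IntervalIntegrable (fun _ : ℝ => C * (p * q * (a - b) ^ 2))
    MeasureTheory.volume 0 1 := intervalIntegrable_const
  have e : p * (∫ t in (0 : ℝ)..1, (sSup (range (k a t)) - sInf (range (k a t))))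
      + q * (∫ t in (0 : ℝ)..1, (sSup (range (k b t)) - sInf (range (k b t))))
      + C * (p * q * (a - b) ^ 2)
      = ∫ t in (0 : ℝ)..1, (p * (sSup (range (k a t)) - sInf (range (k a t)))
        + q * (sSup (range (k b t)) - sInf (range (k b t))) + C * (p * q * (a - b) ^ 2)) := by
    rw [intervalIntegral.integral_add (i1.add i2) i3, intervalIntegral.integral_add i1 i2,
      intervalIntegral.integral_const_mul, intervalIntegral.integral_const_mul]
    simp
  rw [e]
  -- Interior times suffice here; the estimate is assumed only for `0 < t < 1`.
  refine intervalIntegral.integral_mono_on_of_le_Ioo zero_le_one (hint _ hm) ((i1.add i2).add i3)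
    fun t ht => ?_
  refine sSup_sub_sInf_range_le (k := fun s => k s t) (convex_Ioo _ _) (fun s hs => ?_) (h t ht)
    ha hb hp hq hpq
  exact (hk s hs).comp_continuous (f := fun x : L => (t, x)) (by fun_prop)
    (fun x => ⟨Ioo_subset_Icc_self ht, mem_univ _⟩)

end Analysis

/-! ### Almost affine dependence on `s` in coordinates -/

section LocalEstimate

variable {F : Type*} [NormedAddCommGroup F] [NormedSpace ℝ F]
  {E : Type*} [NormedAddCommGroup E] [NormedSpace ℝ E]
  {G : Type*} [NormedAddCommGroup G] [NormedSpace ℝ G]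

/-- If the differentials of `k s` are almost affine in `s`, so are the differences of values. -/
theorem AlmostAffineOn.sub_of_hasFDerivAt {k : ℝ → F → ℝ} {A : ℝ → F → F →L[ℝ] ℝ} {S : Set ℝ}
    {U : Set F} {C : ℝ} (hS : Convex ℝ S) (hU : Convex ℝ U)
    (hk : ∀ s ∈ S, ∀ z ∈ U, HasFDerivAt (k s) (A s z) z)
    (hA : ∀ z ∈ U, AlmostAffineOn S C (fun s => A s z)) {x y : F} (hx : x ∈ U) (hy : y ∈ U) :
    AlmostAffineOn S (C * ‖x - y‖) (fun s => k s x - k s y) := by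
  intro a ha b hb p q hp hq hpq
  have hm : p * a + q * b ∈ S := hS ha hb hp hq hpq
  -- The mean value inequality is applied in `z` to the deviation of `k` itself, whose differential
  -- is the deviation of `A`.
  have key := hU.norm_image_sub_le_of_norm_hasFDerivWithin_le
    (f := fun z => k (p * a + q * b) z - p • k a z - q • k b z)
    (f' := fun z => A (p * a + q * b) z - p • A a z - q • A b z)
    (C := C * (p * q * (a - b) ^ 2))
    (fun z hz => ((((hk _ hm z hz).sub ((hk a ha z hz).const_smul p)).sub
      ((hk b hb z hz).const_smul q)).hasFDerivWithinAt))
    (fun z hz => hA z hz ha hb hp hq hpq) hy hx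
  have e : k (p * a + q * b) x - k (p * a + q * b) y - p • (k a x - k a y) - q • (k b x - k b y)
      = (k (p * a + q * b) x - p • k a x - q • k b x)
        - (k (p * a + q * b) y - p • k a y - q • k b y) := by
    simp only [smul_eq_mul]; ring
  rw [e]
  refine key.trans (le_of_eq ?_)
  ring

/-- The domain of the triples `(s, t, z)` with `t ∈ [0,1]`. -/
def timeSlab (F : Type*) : Set (ℝ × ℝ × F) := univ ×ˢ Icc 0 1 ×ˢ univ

theorem convex_timeSlab : Convex ℝ (timeSlab F) :=
  convex_univ.prod ((convex_Icc _ _).prod convex_univ)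

/-- This makes derivatives within the slab meaningful at `t = 0` and `t = 1`, so local bounds hold
up to the ends of the time interval. -/
theorem uniqueDiffOn_timeSlab : UniqueDiffOn ℝ (timeSlab F) :=
  uniqueDiffOn_univ.prod ((uniqueDiffOn_Icc zero_lt_one).prod uniqueDiffOn_univ)

theorem mem_timeSlab {F : Type*} {s t : ℝ} {z : F} : (s, t, z) ∈ timeSlab F ↔ t ∈ Icc (0 : ℝ) 1 := by
  simp [timeSlab]

/-- A set that is a neighborhood of `(0, t₀, z₀)` within the slab contains a box. -/
theorem exists_box_subset_of_mem_nhdsWithin_timeSlab {F : Type*} [NormedAddCommGroup F] {t₀ : ℝ} {z₀ : F} {N : Set (ℝ × ℝ × F)}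
    (hN : N ∈ nhdsWithin ((0 : ℝ), t₀, z₀) (timeSlab F)) :
    ∃ ε > 0, ∀ s ∈ Ioo (-ε) ε, ∀ t ∈ Icc (0 : ℝ) 1, |t - t₀| < ε → ∀ z ∈ Metric.ball z₀ ε,
      (s, t, z) ∈ N := by
  obtain ⟨ε, hε, h⟩ := Metric.mem_nhdsWithin_iff.1 hN
  refine ⟨ε, hε, fun s hs t ht htt z hz => h ⟨?_, mem_timeSlab.2 ht⟩⟩
  rw [Metric.mem_ball, Prod.dist_eq, Prod.dist_eq, max_lt_iff, max_lt_iff]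
  refine ⟨?_, ?_, hz⟩
  · rw [Real.dist_eq, sub_zero]; exact abs_lt.2 hs
  · rwa [Real.dist_eq]

/-- A `C²` function of `(s, t, z)` is almost affine in `s`, locally uniformly in `(t, z)`. -/
theorem ContDiffWithinAt.exists_almostAffineOn {A : ℝ × ℝ × F → G} {t₀ : ℝ} {z₀ : F}
    (ht₀ : t₀ ∈ Icc (0 : ℝ) 1) (hA : ContDiffWithinAt ℝ 2 A (timeSlab F) (0, t₀, z₀)) :
    ∃ ε > 0, ∃ C : ℝ, 0 ≤ C ∧ ∀ t ∈ Icc (0 : ℝ) 1, |t - t₀| < ε → ∀ z ∈ Metric.ball z₀ ε,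
      AlmostAffineOn (Ioo (-ε) ε) C (fun s => A (s, t, z)) := by
  have h0 : ((0 : ℝ), t₀, z₀) ∈ timeSlab F := mem_timeSlab.2 ht₀
  have hA' : ContDiffWithinAt ℝ 1 (fderivWithin ℝ A (timeSlab F)) (timeSlab F) (0, t₀, z₀) :=
    hA.fderivWithin_right uniqueDiffOn_timeSlab (by norm_num) h0
  obtain ⟨K, N, hN, hK⟩ := hA'.exists_lipschitzOnWith convex_timeSlab
  have hd : ∀ᶠ x in nhdsWithin ((0 : ℝ), t₀, z₀) (timeSlab F),
      DifferentiableWithinAt ℝ A (timeSlab F) x := by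
    have := hA.eventually (by simp)
    rw [insert_eq_of_mem h0] at this
    exact this.mono fun x hx => hx.differentiableWithinAt (by norm_num)
  obtain ⟨ε, hε, hbox⟩ := exists_box_subset_of_mem_nhdsWithin_timeSlab (Filter.inter_mem hN hd)
  refine ⟨ε, hε, K, K.2, fun t ht htt z hz => ?_⟩
  refine AlmostAffineOn.of_hasDerivWithinAt
    (f' := fun s => fderivWithin ℝ A (timeSlab F) (s, t, z) (1, 0, 0)) (convex_Ioo _ _)
    (fun s hs => ?_) (LipschitzOnWith.of_dist_le_mul fun a ha b hb => ?_)
  · have h1 := (hbox s hs t ht htt z hz).2.hasFDerivWithinAt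
    have h2 : HasDerivWithinAt (fun r : ℝ => (r, t, z)) ((1 : ℝ), (0 : ℝ), (0 : F))
        (Ioo (-ε) ε) s :=
      (hasDerivWithinAt_id s _).prodMk ((hasDerivWithinAt_const s _ t).prodMk
        (hasDerivWithinAt_const s _ z))
    exact h1.comp_hasDerivWithinAt s h2 fun r _ => mem_timeSlab.2 ht
  · have h1 := hK.dist_le_mul _ (hbox a ha t ht htt z hz).1 _ (hbox b hb t ht htt z hz).1
    have h2 : Dist.dist (a, t, z) (b, t, z) = Dist.dist a b := by
      simp [Prod.dist_eq]
    rw [h2, dist_eq_norm] at h1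
    rw [dist_eq_norm, ← sub_apply]
    refine (ContinuousLinearMap.le_opNorm _ _).trans ?_
    have h3 : ‖((1 : ℝ), (0 : ℝ), (0 : F))‖ = 1 := by simp [Prod.norm_def]
    rwa [h3, mul_one]

/-- The `1`-form `w ↦ η(∂_t g, ∂_z g · w)` in the variable `z`. -/
noncomputable def velocityForm (η : E → E →L[ℝ] E →L[ℝ] ℝ) (g : ℝ × ℝ × F → E)
    (p : ℝ × ℝ × F) : F →L[ℝ] ℝ :=
  (η (g p) (fderivWithin ℝ g (timeSlab F) p (0, 1, 0))).comp
    ((fderivWithin ℝ g (timeSlab F) p).comp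
      ((ContinuousLinearMap.inr ℝ ℝ (ℝ × F)).comp (ContinuousLinearMap.inr ℝ ℝ F)))

/-- The form contains first derivatives of `g`, hence one order is lost; order two is what
`ContDiffWithinAt.exists_almostAffineOn` requires. -/
theorem ContDiffWithinAt.velocityForm {η : E → E →L[ℝ] E →L[ℝ] ℝ} {g : ℝ × ℝ × F → E}
    {p : ℝ × ℝ × F} (hp : p ∈ timeSlab F) (hη : ContDiffAt ℝ 2 η (g p))
    (hg : ContDiffWithinAt ℝ 3 g (timeSlab F) p) :
    ContDiffWithinAt ℝ 2 (velocityForm η g) (timeSlab F) p := by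
  have hg' : ContDiffWithinAt ℝ 2 (fderivWithin ℝ g (timeSlab F)) (timeSlab F) p :=
    hg.fderivWithin_right uniqueDiffOn_timeSlab (by norm_num) hp
  have hg2 : ContDiffWithinAt ℝ 2 g (timeSlab F) p := hg.of_le (by norm_num)
  exact ((hη.comp_contDiffWithinAt p hg2).clm_apply
    (hg'.clm_apply contDiffWithinAt_const)).clm_comp (hg'.clm_comp contDiffWithinAt_const)

end LocalEstimate

/-! ### The velocity form as the differential of the Hamiltonian -/

namespace HoferLagrangian

variable {E : Type*} [NormedAddCommGroup E] [NormedSpace ℝ E]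
  {M : Type*} [TopologicalSpace M] [ChartedSpace E M]
  {F : Type*} [NormedAddCommGroup F] [NormedSpace ℝ F]
  {L : Type*} [TopologicalSpace L] [ChartedSpace F L]

theorem velocity_eq_mfderiv (γ : ℝ → M) {t : ℝ} (ht : t ∈ Ioo (0 : ℝ) 1) :
    velocity (E := E) γ t = mfderiv 𝓘(ℝ, ℝ) 𝓘(ℝ, E) γ t (1 : ℝ) := by
  rw [velocity, mfderivWithin_of_mem_nhds (Icc_mem_nhds ht.1 ht.2)]

/-- A differentiable curve in the image of a smooth embedding has a tangent velocity. -/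
theorem exists_mfderiv_eq_of_mem_range {ι : L → M}
    (hι : Manifold.IsSmoothEmbedding 𝓘(ℝ, F) 𝓘(ℝ, E) ∞ ι) {σ : ℝ → M} {t : ℝ} {x : L}
    (hσ : ContMDiffAt 𝓘(ℝ, ℝ) 𝓘(ℝ, E) ∞ σ t) (hx : σ t = ι x)
    (hmem : ∀ᶠ τ in nhds t, σ τ ∈ range ι) :
    ∃ w : TangentSpace 𝓘(ℝ, F) x,
      (mfderiv 𝓘(ℝ, ℝ) 𝓘(ℝ, E) σ t (1 : ℝ) : E) = mfderiv 𝓘(ℝ, F) 𝓘(ℝ, E) ι x w := by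
  have : ∃ c : ℝ → L, ∀ τ, σ τ ∈ range ι → ι (c τ) = σ τ := by
    choose c hc using fun τ : ℝ => (show ∃ y, σ τ ∈ range ι → ι y = σ τ by
      by_cases h : σ τ ∈ range ι
      · exact h.imp fun y hy _ => hy
      · exact ⟨x, fun h' => absurd h' h⟩)
    exact ⟨c, hc⟩
  obtain ⟨c, hc⟩ := this
  have hct : c t = x := hι.isEmbedding.injective ((hc t ⟨x, hx.symm⟩).trans hx)
  have hev : ι ∘ c =ᶠ[nhds t] σ := hmem.mono fun τ hτ => hc τ hτ
  have hcomp : ContMDiffAt 𝓘(ℝ, ℝ) 𝓘(ℝ, E) ∞ (ι ∘ c) t := hσ.congr_of_eventuallyEq hev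
  -- The lift `c` was chosen pointwise. It is continuous because `ι` is a topological embedding, and
  -- then smooth because `ι` is an immersion and `ι ∘ c` is smooth.
  have hcs : ContMDiffAt 𝓘(ℝ, ℝ) 𝓘(ℝ, F) ∞ c t :=
    (ContMDiffAt.iff_comp_isImmersionAt (hι.isImmersion.isImmersionAt (c t))).2
      ⟨hι.isEmbedding.isInducing.continuousAt_iff.2 hcomp.continuousAt, hcomp⟩
  subst hct
  refine ⟨mfderiv 𝓘(ℝ, ℝ) 𝓘(ℝ, F) c t (1 : ℝ), ?_⟩
  rw [← hev.mfderiv_eq, mfderiv_comp t (hι.contMDiff.contMDiffAt.mdifferentiableAt (by simp))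
    (hcs.mdifferentiableAt (by simp))]
  rfl

/-- The `1`-form `Ω(dι_t/dt, dι_t ·)` of a Lagrangian path that moves along a Hamiltonian isotopy
is the differential of the restriction of the Hamiltonian function. -/
theorem velocity_form_eq_mfderiv_hamiltonian
    {Ω : ∀ x : M, TangentSpace 𝓘(ℝ, E) x →L[ℝ] TangentSpace 𝓘(ℝ, E) x →L[ℝ] ℝ}
    {H : ℝ → M → ℝ} {ψ : ℝ → Diffeomorph 𝓘(ℝ, E) 𝓘(ℝ, E) M M ∞}
    (hψ : IsHamiltonianIsotopy Ω H ψ) {ι : ℝ → L → M}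
    (hι : ContMDiffOn (𝓘(ℝ, ℝ).prod 𝓘(ℝ, F)) 𝓘(ℝ, E) ∞
      (fun p : ℝ × L => ι p.1 p.2) (Icc 0 1 ×ˢ univ))
    (hmap : ∀ t ∈ Icc (0 : ℝ) 1, ψ t '' range (ι 0) = range (ι t))
    {t : ℝ} (ht : t ∈ Ioo (0 : ℝ) 1) (hL : IsLagrangianEmbedding (F := F) Ω (ι t))
    (x : L) (v : TangentSpace 𝓘(ℝ, F) x) :
    Ω (ι t x) (velocity (fun τ => ι τ x) t) (mfderiv 𝓘(ℝ, F) 𝓘(ℝ, E) (ι t) x v)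
      = mfderiv 𝓘(ℝ, E) 𝓘(ℝ, ℝ) (H t) (ι t x) (mfderiv 𝓘(ℝ, F) 𝓘(ℝ, E) (ι t) x v) := by
  have ht' : t ∈ Icc (0 : ℝ) 1 := Ioo_subset_Icc_self ht
  have hnhds : Icc (0 : ℝ) 1 ∈ nhds t := Icc_mem_nhds ht.1 ht.2
  have hιx : ContMDiffAt 𝓘(ℝ, ℝ) 𝓘(ℝ, E) ∞ (fun τ => ι τ x) t :=
    (hι.contMDiffAt (x := (t, x)) (prod_mem_nhds hnhds Filter.univ_mem)).comp t
      (contMDiffAt_id.prodMk contMDiffAt_const)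
  have hinv : ContMDiffAt 𝓘(ℝ, ℝ) 𝓘(ℝ, E) ∞ (fun τ => (ψ τ).symm (ι τ x)) t :=
    (hψ.smooth_inverse.contMDiffAt (x := (t, ι t x))
      (prod_mem_nhds hnhds Filter.univ_mem)).comp t (contMDiffAt_id.prodMk hιx)
  -- The isotopy carries the moving point `ι τ x` back to the fixed Lagrangian at time `t`, so the
  -- velocity of `σ` is tangent to it.
  set σ : ℝ → M := fun τ => ψ t ((ψ τ).symm (ι τ x)) with hσdef
  have hσ : ContMDiffAt 𝓘(ℝ, ℝ) 𝓘(ℝ, E) ∞ σ t := (ψ t).contMDiff.contMDiffAt.comp t hinv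
  have hσt : σ t = ι t x := (ψ t).apply_symm_apply _
  have hmem : ∀ᶠ τ in nhds t, σ τ ∈ range (ι t) := by
    filter_upwards [hnhds] with τ hτ
    have : ι τ x ∈ ψ τ '' range (ι 0) := by rw [hmap τ hτ]; exact mem_range_self x
    obtain ⟨y, hy, hyx⟩ := this
    rw [← hmap t ht']
    refine ⟨y, hy, ?_⟩
    simp only [hσdef]
    rw [← hyx, (ψ τ).symm_apply_apply]
  obtain ⟨w, hw⟩ := exists_mfderiv_eq_of_mem_range hL.embedding hσ hσt hmem
  -- With `P` the path is `τ ↦ P (τ, σ τ)`. At time `t` the partial derivative of `P` in time is the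
  -- Hamiltonian field and the one in space is the identity, so the velocity is `X t` plus a tangent
  -- vector.
  set P : ℝ × M → M := fun p => ψ p.1 ((ψ t).symm p.2) with hPdef
  have hP : MDifferentiableAt (𝓘(ℝ, ℝ).prod 𝓘(ℝ, E)) 𝓘(ℝ, E) P (t, σ t) := by
    have h1 : ContMDiffAt (𝓘(ℝ, ℝ).prod 𝓘(ℝ, E)) 𝓘(ℝ, E) ∞ (fun p : ℝ × M => ψ p.1 p.2)
        (t, (ψ t).symm (σ t)) :=
      hψ.smooth.contMDiffAt (prod_mem_nhds hnhds Filter.univ_mem)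
    exact (h1.comp (t, σ t) (f := fun p : ℝ × M => (p.1, (ψ t).symm p.2))
      (contMDiffAt_fst.prodMk ((ψ t).symm.contMDiff.contMDiffAt.comp _
        contMDiffAt_snd))).mdifferentiableAt (by simp)
  have hfact : (fun τ => ι τ x) = P ∘ fun τ => (τ, σ τ) := by
    funext τ
    simp only [hPdef, hσdef, Function.comp]
    rw [(ψ t).symm_apply_apply, (ψ τ).apply_symm_apply]
  obtain ⟨X, hX⟩ := hψ.flow
  obtain ⟨hXH, hXv⟩ := hX t ht'
  have hfirst : (mfderiv 𝓘(ℝ, ℝ) 𝓘(ℝ, E) (fun τ => P (τ, σ t)) t (1 : ℝ) : E)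
      = X t (ι t x) := by
    have h := hXv ((ψ t).symm (σ t))
    rw [velocity_eq_mfderiv _ ht] at h
    exact h.trans (congrArg (fun y => (X t y : E)) (((ψ t).apply_symm_apply _).trans hσt))
  have hsecond : mfderiv 𝓘(ℝ, E) 𝓘(ℝ, E) (fun y => P (t, y)) (σ t)
      = ContinuousLinearMap.id ℝ E := by
    have : (fun y => P (t, y)) = id := funext fun y => (ψ t).apply_symm_apply y
    rw [this]
    exact mfderiv_id
  have hvel : (velocity (E := E) (fun τ => ι τ x) t : E)
      = X t (ι t x) + mfderiv 𝓘(ℝ, F) 𝓘(ℝ, E) (ι t) x w := by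
    have hσd := hσ.mdifferentiableAt (by simp)
    have hg := hσd.hasMFDerivAt
    have h1 : HasMFDerivAt 𝓘(ℝ, ℝ) 𝓘(ℝ, E) (P ∘ fun τ => (τ, σ τ)) t
        (((mfderiv (𝓘(ℝ, ℝ).prod 𝓘(ℝ, E)) 𝓘(ℝ, E) P (t, σ t) : ℝ × E →L[ℝ] E)).comp
          ((ContinuousLinearMap.id ℝ ℝ).prod (mfderiv 𝓘(ℝ, ℝ) 𝓘(ℝ, E) σ t : ℝ →L[ℝ] E))) :=
      hP.hasMFDerivAt.comp t ((hasMFDerivAt_id t).prodMk hg)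
    rw [← hfact] at h1
    have h2 := mfderiv_prod_eq_add_apply (I := 𝓘(ℝ, ℝ)) (I' := 𝓘(ℝ, E)) (I'' := 𝓘(ℝ, E))
      (f := P) (p := (t, σ t))
      (v := ((1 : ℝ), (mfderiv 𝓘(ℝ, ℝ) 𝓘(ℝ, E) σ t (1 : ℝ) : E))) hP
    rw [velocity_eq_mfderiv _ ht]
    have h3 : (mfderiv 𝓘(ℝ, ℝ) 𝓘(ℝ, E) (fun τ => ι τ x) t (1 : ℝ) : E)
        = mfderiv (𝓘(ℝ, ℝ).prod 𝓘(ℝ, E)) 𝓘(ℝ, E) P (t, σ t)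
          ((1 : ℝ), (mfderiv 𝓘(ℝ, ℝ) 𝓘(ℝ, E) σ t (1 : ℝ) : E)) :=
      congrArg (fun A : ℝ →L[ℝ] E => A 1) h1.mfderiv
    refine h3.trans (h2.trans ?_)
    refine congrArg₂ (fun a b : E => a + b) hfirst ?_
    exact (congrArg (fun A : E →L[ℝ] E => A _) hsecond).trans hw
  have hadd := congrArg (fun B : E →L[ℝ] ℝ => B (mfderiv 𝓘(ℝ, F) 𝓘(ℝ, E) (ι t) x v))
    ((congrArg (fun u : E => (Ω (ι t x) : E →L[ℝ] E →L[ℝ] ℝ) u) hvel).trans (map_add _ _ _))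
  refine hadd.trans ?_
  have hz := hL.isotropic x w v
  have hH := hXH (ι t x) (mfderiv 𝓘(ℝ, F) 𝓘(ℝ, E) (ι t) x v)
  exact (congrArg₂ (fun a b : ℝ => a + b) hH hz).trans (add_zero _)

end HoferLagrangian

/-! ### Chart expressions of the form and of the variation -/

namespace HoferLagrangian

section Charts

variable {E : Type*} [NormedAddCommGroup E] [NormedSpace ℝ E]
  {M : Type*} [TopologicalSpace M] [ChartedSpace E M] [IsManifold 𝓘(ℝ, E) ∞ M]
  {F : Type*} [NormedAddCommGroup F] [NormedSpace ℝ F]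
  {L : Type*} [TopologicalSpace L] [ChartedSpace F L] [IsManifold 𝓘(ℝ, F) ∞ L]
  {Ω : ∀ x : M, TangentSpace 𝓘(ℝ, E) x →L[ℝ] TangentSpace 𝓘(ℝ, E) x →L[ℝ] ℝ}

/-- The coordinate vector fields of a chart are smooth. -/
theorem contMDiffOn_mfderiv_chartAt_symm (q : M) (u : E) :
    ContMDiffOn 𝓘(ℝ, E) (𝓘(ℝ, E).prod 𝓘(ℝ, E)) ∞
      (fun y => Bundle.TotalSpace.mk' E (E := fun x : M => TangentSpace 𝓘(ℝ, E) x)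
        ((chartAt E q).symm y) (mfderiv 𝓘(ℝ, E) 𝓘(ℝ, E) (chartAt E q).symm y u))
      (chartAt E q).target := by
  have h1 := (contMDiffOn_chart_symm (I := 𝓘(ℝ, E)) (n := ∞)
    (x := q)).contMDiffOn_tangentMapWithin (m := ∞) (by simp)
    (chartAt E q).open_target.uniqueMDiffOn
  have h2 : ContMDiff 𝓘(ℝ, E) (𝓘(ℝ, E).prod 𝓘(ℝ, E)) ∞
      (fun y : E => (⟨y, u⟩ : TangentBundle 𝓘(ℝ, E) E)) := by
    intro y
    exact contMDiffAt_vectorSpace_iff_contDiffAt.2 contDiffAt_const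
  refine (h1.comp h2.contMDiffOn (fun y hy => hy)).congr fun y hy => ?_
  simp only [Function.comp, tangentMapWithin]
  rw [mfderivWithin_of_mem_nhds ((chartAt E q).open_target.mem_nhds hy)]

/-- In finite dimension it suffices to evaluate on constant vectors `u`, `v`. Each coefficient is
then the smooth section `Ω` paired with two coordinate fields. -/
theorem IsSymplecticForm.contDiffAt_chartForm [FiniteDimensional ℝ E] (hΩ : IsSymplecticForm Ω)
    (q : M) {y : E} (hy : y ∈ (chartAt E q).target) :
    ContDiffAt ℝ ∞ (chartForm Ω q) y := by
  refine ContDiffOn.contDiffAt ?_ ((chartAt E q).open_target.mem_nhds hy)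
  rw [contDiffOn_clm_apply]
  intro u
  rw [contDiffOn_clm_apply]
  intro v
  rw [← contMDiffOn_iff_contDiffOn]
  have hb := contMDiffOn_chart_symm (I := 𝓘(ℝ, E)) (n := ∞) (x := q)
  have key : ContMDiffOn 𝓘(ℝ, E) (𝓘(ℝ, E).prod 𝓘(ℝ)) ∞
      (fun y => Bundle.TotalSpace.mk' ℝ (E := Bundle.Trivial M ℝ) ((chartAt E q).symm y)
        (Ω ((chartAt E q).symm y) (mfderiv 𝓘(ℝ, E) 𝓘(ℝ, E) (chartAt E q).symm y u)
          (mfderiv 𝓘(ℝ, E) 𝓘(ℝ, E) (chartAt E q).symm y v))) (chartAt E q).target := by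
    apply ContMDiffOn.clm_bundle_apply₂ (F₁ := E) (F₂ := E)
    · exact hΩ.smooth.comp_contMDiffOn hb
    · exact contMDiffOn_mfderiv_chartAt_symm q u
    · exact contMDiffOn_mfderiv_chartAt_symm q v
  intro y hy
  have := key y hy
  rw [Bundle.contMDiffWithinAt_totalSpace] at this
  exact this.2

/-- A family of maps `L → M` in the charts at `p` and `q`. -/
def chartFamily (Φ : ℝ → ℝ → L → M) (p : L) (q : M) (a : ℝ × ℝ × F) : E :=
  chartAt E q (Φ a.1 a.2.1 ((chartAt F p).symm a.2.2))

variable {Φ : ℝ → ℝ → L → M} {I : Set ℝ}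

theorem contDiffWithinAt_chartFamily (hI : IsOpen I)
    (hΦ : ContMDiffOn (𝓘(ℝ, ℝ).prod (𝓘(ℝ, ℝ).prod 𝓘(ℝ, F))) 𝓘(ℝ, E) ∞
      (fun p : ℝ × ℝ × L => Φ p.1 p.2.1 p.2.2) (I ×ˢ Icc 0 1 ×ˢ univ))
    {p : L} {q : M} {s t : ℝ} {z : F} (hs : s ∈ I) (ht : t ∈ Icc (0 : ℝ) 1)
    (hz : z ∈ (chartAt F p).target) (hq : Φ s t ((chartAt F p).symm z) ∈ (chartAt E q).source) :
    ContDiffWithinAt ℝ ∞ (chartFamily (E := E) (F := F) Φ p q) (timeSlab F) (s, t, z) := by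
  have hmem : I ×ˢ Icc (0 : ℝ) 1 ×ˢ (chartAt F p).target ∈ nhdsWithin (s, t, z) (timeSlab F) := by
    have h1 : I ×ˢ (univ : Set ℝ) ×ˢ (chartAt F p).target ∈ nhds (s, t, z) :=
      prod_mem_nhds (hI.mem_nhds hs)
        (prod_mem_nhds Filter.univ_mem ((chartAt F p).open_target.mem_nhds hz))
    filter_upwards [mem_nhdsWithin_of_mem_nhds h1, self_mem_nhdsWithin] with a h2 h3
    exact ⟨h2.1, h3.2.1, h2.2.2⟩
  refine ContDiffWithinAt.mono_of_mem_nhdsWithin ?_ hmem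
  rw [← contMDiffWithinAt_iff_contDiffWithinAt]
  have he : ContMDiffOn 𝓘(ℝ, ℝ × ℝ × F) (𝓘(ℝ, ℝ).prod (𝓘(ℝ, ℝ).prod 𝓘(ℝ, F))) ∞
      (fun a : ℝ × ℝ × F => (a.1, a.2.1, (chartAt F p).symm a.2.2))
      (I ×ˢ Icc (0 : ℝ) 1 ×ˢ (chartAt F p).target) := by
    refine ContMDiffOn.prodMk contDiff_fst.contMDiff.contMDiffOn
      (ContMDiffOn.prodMk (contDiff_fst.comp contDiff_snd).contMDiff.contMDiffOn ?_)
    exact (contMDiffOn_chart_symm (I := 𝓘(ℝ, F)) (n := ∞) (x := p)).comp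
      (contDiff_snd.comp contDiff_snd).contMDiff.contMDiffOn fun a ha => ha.2.2
  have h1 := hΦ.comp he fun a ha => ⟨ha.1, ha.2.1, mem_univ _⟩
  exact ((contMDiffOn_chart (I := 𝓘(ℝ, E)) (n := ∞) (x := q)).contMDiffAt
    ((chartAt E q).open_source.mem_nhds hq)).comp_contMDiffWithinAt (s, t, z)
    (h1 (s, t, z) ⟨hs, ht, hz⟩)

/-- In charts, the `1`-form `Ω(dι_t/dt, dι_t ·)` is the velocity form of the chart expressions. -/
theorem velocityForm_chartFamily_apply (hI : IsOpen I)
    (hΦ : ContMDiffOn (𝓘(ℝ, ℝ).prod (𝓘(ℝ, ℝ).prod 𝓘(ℝ, F))) 𝓘(ℝ, E) ∞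
      (fun p : ℝ × ℝ × L => Φ p.1 p.2.1 p.2.2) (I ×ˢ Icc 0 1 ×ˢ univ))
    {p : L} {q : M} {s t : ℝ} {z : F} (hs : s ∈ I) (ht : t ∈ Ioo (0 : ℝ) 1)
    (hz : z ∈ (chartAt F p).target) (hq : Φ s t ((chartAt F p).symm z) ∈ (chartAt E q).source)
    (w : F) :
    velocityForm (chartForm Ω q) (chartFamily Φ p q) (s, t, z) w
      = Ω (Φ s t ((chartAt F p).symm z))
        (velocity (fun τ => Φ s τ ((chartAt F p).symm z)) t)
        (mfderiv 𝓘(ℝ, F) 𝓘(ℝ, E) (fun z' => Φ s t ((chartAt F p).symm z')) z w) := by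
  set χ := chartAt E q with hχ
  set φ := chartAt F p with hφ
  set g : ℝ × ℝ × F → E := chartFamily Φ p q with hg
  have hslab : timeSlab F ∈ nhds (s, t, z) :=
    prod_mem_nhds Filter.univ_mem
      (prod_mem_nhds (Icc_mem_nhds ht.1 ht.2) Filter.univ_mem)
  have hgd : HasFDerivAt g (fderivWithin ℝ g (timeSlab F) (s, t, z)) (s, t, z) :=
    ((contDiffWithinAt_chartFamily hI hΦ hs (Ioo_subset_Icc_self ht) hz
      hq).differentiableWithinAt (by simp)).hasFDerivWithinAt.hasFDerivAt hslab
  set g' := fderivWithin ℝ g (timeSlab F) (s, t, z) with hg'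
  have hgt : g (s, t, z) ∈ χ.target := χ.map_source hq
  have hχd : HasMFDerivAt 𝓘(ℝ, E) 𝓘(ℝ, E) χ.symm (g (s, t, z))
      (mfderiv 𝓘(ℝ, E) 𝓘(ℝ, E) χ.symm (g (s, t, z))) :=
    ((contMDiffOn_chart_symm (I := 𝓘(ℝ, E)) (n := ∞) (x := q)).contMDiffAt
      (χ.open_target.mem_nhds hgt)).mdifferentiableAt (by simp) |>.hasMFDerivAt
  have hcont : ContinuousAt (fun a : ℝ × ℝ × F => Φ a.1 a.2.1 (φ.symm a.2.2)) (s, t, z) := by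
    have h1 : ContinuousAt (fun a : ℝ × ℝ × L => Φ a.1 a.2.1 a.2.2) (s, t, φ.symm z) :=
      hΦ.continuousOn.continuousAt (prod_mem_nhds (hI.mem_nhds hs)
        (prod_mem_nhds (Icc_mem_nhds ht.1 ht.2) Filter.univ_mem))
    have h2 : ContinuousAt (fun a : ℝ × ℝ × F => (a.1, a.2.1, φ.symm a.2.2)) (s, t, z) := by
      refine continuousAt_fst.prodMk ((continuousAt_fst.comp continuousAt_snd).prodMk ?_)
      exact ContinuousAt.comp (f := fun a : ℝ × ℝ × F => a.2.2) (φ.continuousAt_symm hz)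
        (continuousAt_snd.comp continuousAt_snd)
    exact ContinuousAt.comp (f := fun a : ℝ × ℝ × F => (a.1, a.2.1, φ.symm a.2.2)) h1 h2
  -- Near the point `Φ` factors through the inverse chart, so both arguments of `Ω` are images under
  -- its differential, exactly what `chartForm` absorbs.
  have hev : ∀ᶠ a : ℝ × ℝ × F in nhds (s, t, z),
      Φ a.1 a.2.1 (φ.symm a.2.2) = χ.symm (g a) :=
    (hcont.eventually (χ.open_source.mem_nhds hq)).mono fun a ha => (χ.left_inv ha).symm
  have ht1 : HasMFDerivAt 𝓘(ℝ, ℝ) 𝓘(ℝ, E) (fun τ => Φ s τ (φ.symm z)) t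
      (((mfderiv 𝓘(ℝ, E) 𝓘(ℝ, E) χ.symm (g (s, t, z))) : E →L[ℝ] E).comp
        (g'.comp ((ContinuousLinearMap.inr ℝ ℝ (ℝ × F)).comp
          (ContinuousLinearMap.inl ℝ ℝ F)))) := by
    have h1 : HasFDerivAt (fun τ : ℝ => (s, τ, z)) ((ContinuousLinearMap.inr ℝ ℝ (ℝ × F)).comp
          (ContinuousLinearMap.inl ℝ ℝ F)) t := by
      refine ((hasFDerivAt_const s t).prodMk ((hasFDerivAt_id t).prodMk (hasFDerivAt_const z t))).congr_fderiv ?_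
      ext <;> simp
    have h2 := HasFDerivAt.comp (g := g) t hgd h1
    refine (HasMFDerivAt.comp t hχd h2.hasMFDerivAt).congr_of_eventuallyEq ?_
    exact (h1.continuousAt.eventually hev)
  have hz1 : HasMFDerivAt 𝓘(ℝ, F) 𝓘(ℝ, E) (fun z' => Φ s t (φ.symm z')) z
      (((mfderiv 𝓘(ℝ, E) 𝓘(ℝ, E) χ.symm (g (s, t, z))) : E →L[ℝ] E).comp
        (g'.comp ((ContinuousLinearMap.inr ℝ ℝ (ℝ × F)).comp
          (ContinuousLinearMap.inr ℝ ℝ F)))) := by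
    have h1 : HasFDerivAt (fun z' : F => (s, t, z')) ((ContinuousLinearMap.inr ℝ ℝ (ℝ × F)).comp
          (ContinuousLinearMap.inr ℝ ℝ F)) z := by
      refine ((hasFDerivAt_const s z).prodMk ((hasFDerivAt_const t z).prodMk (hasFDerivAt_id z))).congr_fderiv ?_
      ext <;> simp
    have h2 := HasFDerivAt.comp (g := g) z hgd h1
    refine (HasMFDerivAt.comp z hχd h2.hasMFDerivAt).congr_of_eventuallyEq ?_
    exact (h1.continuousAt.eventually hev)
  have hpt : χ.symm (g (s, t, z)) = Φ s t (φ.symm z) := χ.left_inv hq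
  have e1 : (velocity (E := E) (fun τ => Φ s τ (φ.symm z)) t : E)
      = (mfderiv 𝓘(ℝ, E) 𝓘(ℝ, E) χ.symm (g (s, t, z)) : E →L[ℝ] E) (g' (0, 1, 0)) := by
    rw [velocity_eq_mfderiv _ ht]
    exact congrArg (fun A : ℝ →L[ℝ] E => A 1) ht1.mfderiv
  have e2 : (mfderiv 𝓘(ℝ, F) 𝓘(ℝ, E) (fun z' => Φ s t (φ.symm z')) z w : E)
      = (mfderiv 𝓘(ℝ, E) 𝓘(ℝ, E) χ.symm (g (s, t, z)) : E →L[ℝ] E) (g' (0, 0, w)) :=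
    congrArg (fun A : F →L[ℝ] E => A w) hz1.mfderiv
  have e3 : ∀ u v : E, (Ω (χ.symm (g (s, t, z))) : E →L[ℝ] E →L[ℝ] ℝ) u v
      = (Ω (Φ s t (φ.symm z)) : E →L[ℝ] E →L[ℝ] ℝ) u v := by
    intro u v
    rw [hpt]
  refine (e3 _ _).trans ?_
  exact congrArg₂ (fun u v : E => (Ω (Φ s t (φ.symm z)) : E →L[ℝ] E →L[ℝ] ℝ) u v) e1.symm e2.symm

end Charts

end HoferLagrangian

/-! ### Local estimate along the variation -/

namespace HoferLagrangian

section Variation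

variable {E : Type*} [NormedAddCommGroup E] [NormedSpace ℝ E]
  {M : Type*} [TopologicalSpace M] [ChartedSpace E M] [IsManifold 𝓘(ℝ, E) ∞ M]
  {F : Type*} [NormedAddCommGroup F] [NormedSpace ℝ F]
  {L : Type*} [TopologicalSpace L] [ChartedSpace F L] [IsManifold 𝓘(ℝ, F) ∞ L]
  {Ω : ∀ x : M, TangentSpace 𝓘(ℝ, E) x →L[ℝ] TangentSpace 𝓘(ℝ, E) x →L[ℝ] ℝ}
  {Φ : ℝ → ℝ → L → M} {I : Set ℝ}

/-- In a chart of `L`, the differential of the Hamiltonian function along the variation is the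
velocity form. -/
theorem hasFDerivAt_hamiltonian_chart (hI : IsOpen I)
    (hΦ : ContMDiffOn (𝓘(ℝ, ℝ).prod (𝓘(ℝ, ℝ).prod 𝓘(ℝ, F))) 𝓘(ℝ, E) ∞
      (fun p : ℝ × ℝ × L => Φ p.1 p.2.1 p.2.2) (I ×ˢ Icc 0 1 ×ˢ univ))
    {H : ℝ → M → ℝ} {ψ : ℝ → Diffeomorph 𝓘(ℝ, E) 𝓘(ℝ, E) M M ∞}
    (hψ : IsHamiltonianIsotopy Ω H ψ) {s t : ℝ} (hs : s ∈ I) (ht : t ∈ Ioo (0 : ℝ) 1)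
    (hmap : ∀ t ∈ Icc (0 : ℝ) 1, ψ t '' range (Φ s 0) = range (Φ s t))
    (hL : IsLagrangianEmbedding (F := F) Ω (Φ s t))
    {p : L} {q : M} {z : F} (hz : z ∈ (chartAt F p).target)
    (hq : Φ s t ((chartAt F p).symm z) ∈ (chartAt E q).source) :
    HasFDerivAt (fun z' => H t (Φ s t ((chartAt F p).symm z')))
      (velocityForm (chartForm Ω q) (chartFamily Φ p q) (s, t, z)) z := by
  set φ := chartAt F p with hφ
  have hιs : ContMDiffOn (𝓘(ℝ, ℝ).prod 𝓘(ℝ, F)) 𝓘(ℝ, E) ∞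
      (fun a : ℝ × L => Φ s a.1 a.2) (Icc 0 1 ×ˢ univ) :=
    hΦ.comp (contMDiff_const.prodMk contMDiff_id).contMDiffOn fun a ha => ⟨hs, ha⟩
  have hφd : MDifferentiableAt 𝓘(ℝ, F) 𝓘(ℝ, F) φ.symm z :=
    ((contMDiffOn_chart_symm (I := 𝓘(ℝ, F)) (n := ∞) (x := p)).contMDiffAt
      (φ.open_target.mem_nhds hz)).mdifferentiableAt (by simp)
  have hΦd : MDifferentiableAt 𝓘(ℝ, F) 𝓘(ℝ, E) (Φ s t) (φ.symm z) :=
    hL.embedding.contMDiff.contMDiffAt.mdifferentiableAt (by simp)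
  have hHd : MDifferentiableAt 𝓘(ℝ, E) 𝓘(ℝ, ℝ) (H t) (Φ s t (φ.symm z)) := by
    have h1 : ContMDiffAt (𝓘(ℝ, ℝ).prod 𝓘(ℝ, E)) 𝓘(ℝ, ℝ) ∞ (fun a : ℝ × M => H a.1 a.2)
        (t, Φ s t (φ.symm z)) :=
      hψ.smooth_hamiltonian.contMDiffAt
        (prod_mem_nhds (Icc_mem_nhds ht.1 ht.2) Filter.univ_mem)
    exact (h1.comp (Φ s t (φ.symm z)) (f := fun y : M => (t, y))
      (contMDiffAt_const.prodMk contMDiffAt_id)).mdifferentiableAt (by simp)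
  have hcomp := hΦd.hasMFDerivAt.comp z hφd.hasMFDerivAt
  have hd := (hHd.hasMFDerivAt.comp z hcomp).hasFDerivAt
  refine hd.congr_fderiv ?_
  refine ContinuousLinearMap.ext fun w : F => ?_
  have key := velocity_form_eq_mfderiv_hamiltonian hψ hιs hmap ht hL (φ.symm z)
    (mfderiv 𝓘(ℝ, F) 𝓘(ℝ, F) φ.symm z w)
  refine key.symm.trans (Eq.trans ?_ (velocityForm_chartFamily_apply hI hΦ hs ht hz hq w).symm)
  exact congrArg (fun u : E => (Ω (Φ s t (φ.symm z)) : E →L[ℝ] E →L[ℝ] ℝ)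
    (velocity (fun τ => Φ s τ (φ.symm z)) t) u)
    (congrArg (fun A : F →L[ℝ] E => A w) hcomp.mfderiv).symm

/-- Differences of values of the Hamiltonian functions along the variation are almost affine in
`s`, locally in `t` and on `L`. -/
theorem exists_almostAffineOn_hamiltonian_local [FiniteDimensional ℝ E] (hΩ : IsSymplecticForm Ω)
    (hI : IsOpen I) (hI0 : (0 : ℝ) ∈ I)
    (hΦ : ContMDiffOn (𝓘(ℝ, ℝ).prod (𝓘(ℝ, ℝ).prod 𝓘(ℝ, F))) 𝓘(ℝ, E) ∞
      (fun p : ℝ × ℝ × L => Φ p.1 p.2.1 p.2.2) (I ×ˢ Icc 0 1 ×ˢ univ))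
    (hL : ∀ s ∈ I, ∀ t ∈ Icc (0 : ℝ) 1, IsLagrangianEmbedding (F := F) Ω (Φ s t))
    {H : ℝ → ℝ → M → ℝ} {ψ : ℝ → ℝ → Diffeomorph 𝓘(ℝ, E) 𝓘(ℝ, E) M M ∞}
    (hψ : ∀ s ∈ I, IsHamiltonianIsotopy Ω (H s) (ψ s))
    (hmap : ∀ s ∈ I, ∀ t ∈ Icc (0 : ℝ) 1, ψ s t '' range (Φ s 0) = range (Φ s t))
    (p : L) {t₀ : ℝ} (ht₀ : t₀ ∈ Icc (0 : ℝ) 1) :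
    ∃ ε > 0, ∃ C : ℝ, ∃ U ∈ nhds p, ∀ t ∈ Ioo (0 : ℝ) 1, |t - t₀| < ε → ∀ x ∈ U, ∀ y ∈ U,
      AlmostAffineOn (Ioo (-ε) ε) C (fun s => H s t (Φ s t x) - H s t (Φ s t y)) := by
  set q : M := Φ 0 t₀ p with hq
  set φ := chartAt F p with hφ
  set z₀ : F := φ p with hz₀
  have hz₀t : z₀ ∈ φ.target := φ.map_source (mem_chart_source F p)
  have hpz : φ.symm z₀ = p := φ.left_inv (mem_chart_source F p)
  have hq0 : Φ 0 t₀ (φ.symm z₀) ∈ (chartAt E q).source := by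
    rw [hpz]; exact mem_chart_source E q
  have hg := contDiffWithinAt_chartFamily (E := E) hI hΦ hI0 ht₀ hz₀t hq0
  have hgt : chartFamily (E := E) Φ p q ((0 : ℝ), t₀, z₀) ∈ (chartAt E q).target :=
    (chartAt E q).map_source hq0
  have hA : ContDiffWithinAt ℝ 2 (velocityForm (chartForm Ω q) (chartFamily (E := E) Φ p q))
      (timeSlab F) (0, t₀, z₀) :=
    ContDiffWithinAt.velocityForm (mem_timeSlab.2 ht₀)
      ((hΩ.contDiffAt_chartForm q hgt).of_le ENat.LEInfty.out)
      (hg.of_le ENat.LEInfty.out)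
  obtain ⟨ε₁, hε₁, C, hC, hAff⟩ := hA.exists_almostAffineOn ht₀
  have hN : {a : ℝ × ℝ × F | a.1 ∈ I ∧ a.2.2 ∈ φ.target ∧
      Φ a.1 a.2.1 (φ.symm a.2.2) ∈ (chartAt E q).source} ∈
      nhdsWithin ((0 : ℝ), t₀, z₀) (timeSlab F) := by
    have h1 : I ×ˢ (univ : Set ℝ) ×ˢ φ.target ∈ nhds ((0 : ℝ), t₀, z₀) :=
      prod_mem_nhds (hI.mem_nhds hI0)
        (prod_mem_nhds Filter.univ_mem (φ.open_target.mem_nhds hz₀t))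
    have h2 : ContinuousOn (fun a : ℝ × ℝ × F => Φ a.1 a.2.1 (φ.symm a.2.2))
        (I ×ˢ Icc (0 : ℝ) 1 ×ˢ φ.target) := by
      refine hΦ.continuousOn.comp (f := fun a : ℝ × ℝ × F => (a.1, a.2.1, φ.symm a.2.2)) ?_
        fun a ha => ⟨ha.1, ha.2.1, mem_univ _⟩
      refine continuousOn_fst.prodMk (ContinuousOn.prodMk (by fun_prop) ?_)
      exact φ.continuousOn_symm.comp (by fun_prop) fun a ha => ha.2.2
    have h3 : I ×ˢ Icc (0 : ℝ) 1 ×ˢ φ.target ∈ nhdsWithin ((0 : ℝ), t₀, z₀) (timeSlab F) := by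
      filter_upwards [mem_nhdsWithin_of_mem_nhds h1, self_mem_nhdsWithin] with a h4 h5
      exact ⟨h4.1, h5.2.1, h4.2.2⟩
    have h4 := (h2 ((0 : ℝ), t₀, z₀) ⟨hI0, ht₀, hz₀t⟩).mono_of_mem_nhdsWithin h3
    filter_upwards [h3, h4.preimage_mem_nhdsWithin
      ((chartAt E q).open_source.mem_nhds hq0)] with a h5 h6
    exact ⟨h5.1, h5.2.2, h6⟩
  obtain ⟨ε₂, hε₂, hbox⟩ := exists_box_subset_of_mem_nhdsWithin_timeSlab hN
  set ε := min ε₁ ε₂ with hε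
  have hε0 : 0 < ε := lt_min hε₁ hε₂
  have hε1 : ε ≤ ε₁ := min_le_left _ _
  have hε2 : ε ≤ ε₂ := min_le_right _ _
  -- The factor `2 * ε` bounds the distance of two points of the coordinate ball.
  refine ⟨ε, hε0, C * (2 * ε), φ.source ∩ φ ⁻¹' Metric.ball z₀ ε,
    Filter.inter_mem (φ.open_source.mem_nhds (mem_chart_source F p))
      ((φ.continuousAt (mem_chart_source F p)).preimage_mem_nhds (Metric.ball_mem_nhds _ hε0)),
    fun t ht htt x hx y hy => ?_⟩
  have ht' := Ioo_subset_Icc_self ht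
  have hbox' : ∀ s ∈ Ioo (-ε) ε, ∀ z ∈ Metric.ball z₀ ε, s ∈ I ∧ z ∈ φ.target ∧
      Φ s t (φ.symm z) ∈ (chartAt E q).source := fun s hs z hz =>
    hbox s (Ioo_subset_Ioo (neg_le_neg hε2) hε2 hs) t ht' (htt.trans_le hε2) z
      (Metric.ball_subset_ball hε2 hz)
  have key := AlmostAffineOn.sub_of_hasFDerivAt
    (k := fun s z => H s t (Φ s t (φ.symm z)))
    (A := fun s z => velocityForm (chartForm Ω q) (chartFamily (E := E) Φ p q) (s, t, z))
    (convex_Ioo (-ε) ε) (convex_ball z₀ ε)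
    (fun s hs z hz => by
      obtain ⟨h1, h2, h3⟩ := hbox' s hs z hz
      exact hasFDerivAt_hamiltonian_chart hI hΦ (hψ s h1) h1 ht (hmap s h1) (hL s h1 t ht') h2 h3)
    (fun z hz => (hAff t ht' (htt.trans_le hε1) z (Metric.ball_subset_ball hε1 hz)).mono
      (Ioo_subset_Ioo (neg_le_neg hε1) hε1) le_rfl) hx.2 hy.2
  simp only [φ.left_inv hx.1, φ.left_inv hy.1] at key
  refine key.mono subset_rfl (mul_le_mul_of_nonneg_left ?_ hC)
  rw [← dist_eq_norm]
  have h1 := Metric.mem_ball.1 hx.2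
  have h2 := Metric.mem_ball.1 hy.2
  linarith [dist_triangle_right (φ x) (φ y) z₀]

end Variation

/-! ### From local to uniform estimates -/

/-- Differences of values that are locally almost affine on a compact connected space, locally
uniformly in the time, are uniformly almost affine. -/
theorem exists_almostAffineOn_sub_of_local {L : Type*} [TopologicalSpace L] [CompactSpace L]
    [ConnectedSpace L] {k : ℝ → ℝ → L → ℝ}
    (h : ∀ p : L, ∀ t₀ ∈ Icc (0 : ℝ) 1, ∃ ε > 0, ∃ C : ℝ, ∃ U ∈ nhds p, ∀ t ∈ Ioo (0 : ℝ) 1,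
      |t - t₀| < ε → ∀ x ∈ U, ∀ y ∈ U,
        AlmostAffineOn (Ioo (-ε) ε) C (fun s => k s t x - k s t y)) :
    ∃ ε > 0, ∃ C : ℝ, ∀ t ∈ Ioo (0 : ℝ) 1, ∀ x y,
      AlmostAffineOn (Ioo (-ε) ε) C (fun s => k s t x - k s t y) := by
  have shrink : ∀ {ε ε' C C' : ℝ} {f : ℝ → ℝ}, AlmostAffineOn (Ioo (-ε) ε) C f → ε' ≤ ε →
      C ≤ C' → AlmostAffineOn (Ioo (-ε') ε') C' f := fun hf he hC =>
    hf.mono (Ioo_subset_Ioo (neg_le_neg he) he) hC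
  -- Compactness of the closed time interval removes the dependence on `t₀`; base times `0` and `1`
  -- are needed to control interior times near the ends.
  have loc : ∀ p : L, ∃ ε > 0, ∃ C : ℝ, ∃ U ∈ nhds p, ∀ t ∈ Ioo (0 : ℝ) 1, ∀ x ∈ U, ∀ y ∈ U,
      AlmostAffineOn (Ioo (-ε) ε) C (fun s => k s t x - k s t y) := by
    intro p
    have : ∃ ε > 0, ∃ C : ℝ, ∃ U ∈ nhds p, ∀ t ∈ Icc (0 : ℝ) 1, t ∈ Ioo (0 : ℝ) 1 →
        ∀ x ∈ U, ∀ y ∈ U,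
        AlmostAffineOn (Ioo (-ε) ε) C (fun s => k s t x - k s t y) := by
      refine isCompact_Icc.induction_on (p := fun T : Set ℝ => ∃ ε > 0, ∃ C : ℝ, ∃ U ∈ nhds p,
        ∀ t ∈ T, t ∈ Ioo (0 : ℝ) 1 → ∀ x ∈ U, ∀ y ∈ U,
          AlmostAffineOn (Ioo (-ε) ε) C (fun s => k s t x - k s t y)) ?_ ?_ ?_ ?_
      · exact ⟨1, one_pos, 0, univ, Filter.univ_mem, fun t ht => absurd ht (notMem_empty t)⟩
      · rintro S T hST ⟨ε, hε, C, U, hU, hT⟩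
        exact ⟨ε, hε, C, U, hU, fun t ht => hT t (hST ht)⟩
      · rintro S T ⟨ε, hε, C, U, hU, hS⟩ ⟨ε', hε', C', U', hU', hT⟩
        refine ⟨min ε ε', lt_min hε hε', max C C', U ∩ U', Filter.inter_mem hU hU', ?_⟩
        rintro t (ht | ht) ht1 x hx y hy
        · exact shrink (hS t ht ht1 x hx.1 y hy.1) (min_le_left _ _) (le_max_left _ _)
        · exact shrink (hT t ht ht1 x hx.2 y hy.2) (min_le_right _ _) (le_max_right _ _)
      · intro t₀ ht₀
        obtain ⟨ε, hε, C, U, hU, hh⟩ := h p t₀ ht₀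
        refine ⟨Metric.ball t₀ ε, mem_nhdsWithin_of_mem_nhds (Metric.ball_mem_nhds _ hε),
          ε, hε, C, U, hU, fun t ht ht1 => hh t ht1 ?_⟩
        rwa [← Real.dist_eq]
    obtain ⟨ε, hε, C, U, hU, hh⟩ := this
    exact ⟨ε, hε, C, U, hU, fun t ht => hh t (Ioo_subset_Icc_self ht) ht⟩
  obtain ⟨x₀⟩ := (inferInstance : Nonempty L)
  -- Connectedness compares every point with the base point `x₀`. Here `ε` and `C` may depend on
  -- `y`; compactness of `L` makes them uniform afterwards.
  set Q : Set L := {y | ∃ ε > 0, ∃ C : ℝ, ∃ U ∈ nhds y, ∀ t ∈ Ioo (0 : ℝ) 1, ∀ x ∈ U,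
    AlmostAffineOn (Ioo (-ε) ε) C (fun s => k s t x - k s t x₀)} with hQ
  have hQne : Q.Nonempty := by
    obtain ⟨ε, hε, C, U, hU, hh⟩ := loc x₀
    exact ⟨x₀, ε, hε, C, U, hU, fun t ht x hx => hh t ht x hx x₀ (mem_of_mem_nhds hU)⟩
  have hQopen : IsOpen Q := by
    rw [isOpen_iff_mem_nhds]
    rintro y ⟨ε, hε, C, U, hU, hh⟩
    filter_upwards [eventually_mem_nhds_iff.2 hU] with z hz
    exact ⟨ε, hε, C, U, hz, hh⟩
  have hQclosed : IsClosed Q := by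
    refine isClosed_of_closure_subset fun z hz => ?_
    obtain ⟨ε, hε, C, U, hU, hh⟩ := loc z
    -- A point `y` of `Q` close to `z` links `x` to `x₀`, and the two constants add.
    obtain ⟨y, hyU, ε', hε', C', U', hU', hh'⟩ := mem_closure_iff_nhds.1 hz U hU
    refine ⟨min ε ε', lt_min hε hε', C + C', U, hU, fun t ht x hx => ?_⟩
    have h1 := shrink (hh t ht x hx y hyU) (min_le_left ε ε') le_rfl
    have h2 := shrink (hh' t ht y (mem_of_mem_nhds hU')) (min_le_right ε ε') le_rfl
    simpa only [sub_add_sub_cancel] using h1.add h2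
  have hQuniv : Q = univ := IsClopen.eq_univ ⟨hQclosed, hQopen⟩ hQne
  have glob : ∃ ε > 0, ∃ C : ℝ, ∀ t ∈ Ioo (0 : ℝ) 1, ∀ x ∈ (univ : Set L),
      AlmostAffineOn (Ioo (-ε) ε) C (fun s => k s t x - k s t x₀) := by
    refine isCompact_univ.induction_on (p := fun T : Set L => ∃ ε > 0, ∃ C : ℝ,
      ∀ t ∈ Ioo (0 : ℝ) 1, ∀ x ∈ T,
        AlmostAffineOn (Ioo (-ε) ε) C (fun s => k s t x - k s t x₀)) ?_ ?_ ?_ ?_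
    · exact ⟨1, one_pos, 0, fun t _ x hx => absurd hx (notMem_empty x)⟩
    · rintro S T hST ⟨ε, hε, C, hT⟩
      exact ⟨ε, hε, C, fun t ht x hx => hT t ht x (hST hx)⟩
    · rintro S T ⟨ε, hε, C, hS⟩ ⟨ε', hε', C', hT⟩
      refine ⟨min ε ε', lt_min hε hε', max C C', ?_⟩
      rintro t ht x (hx | hx)
      · exact shrink (hS t ht x hx) (min_le_left _ _) (le_max_left _ _)
      · exact shrink (hT t ht x hx) (min_le_right _ _) (le_max_right _ _)
    · intro y _
      obtain ⟨ε, hε, C, U, hU, hh⟩ : y ∈ Q := hQuniv ▸ mem_univ y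
      exact ⟨U, mem_nhdsWithin_of_mem_nhds hU, ε, hε, C, hh⟩
  obtain ⟨ε, hε, C, hh⟩ := glob
  refine ⟨ε, hε, C + C, fun t ht x y => ?_⟩
  have := (hh t ht x (mem_univ x)).add (hh t ht y (mem_univ y)).neg
  refine (funext fun s => ?_ : (fun s => k s t x - k s t y) = _) ▸ this
  ring

end HoferLagrangian

/-! ### Conclusion for the length function -/

open HoferLagrangian in
/-- For every length function `l` of an exact variation of a regular exact Lagrangian path there
are a convex function `u` and `δ, C > 0` with `|l(s) - u(s)| ≤ C s²` for `|s| < δ`. -/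
theorem proposition6
    {E : Type*} [NormedAddCommGroup E] [NormedSpace ℝ E] [FiniteDimensional ℝ E]
    {M : Type*} [TopologicalSpace M] [ChartedSpace E M] [IsManifold 𝓘(ℝ, E) ∞ M]
    [T2Space M] [SecondCountableTopology M] [ConnectedSpace M]
    (Ω : ∀ x : M, TangentSpace 𝓘(ℝ, E) x →L[ℝ] TangentSpace 𝓘(ℝ, E) x →L[ℝ] ℝ)
    (hΩ : HoferLagrangian.IsSymplecticForm Ω)
    {F : Type*} [NormedAddCommGroup F] [NormedSpace ℝ F] [FiniteDimensional ℝ F]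
    {L : Type*} [TopologicalSpace L] [ChartedSpace F L] [IsManifold 𝓘(ℝ, F) ∞ L]
    [T2Space L] [CompactSpace L] [ConnectedSpace L]
    (j : L → M) (hj : HoferLagrangian.IsLagrangianEmbedding (F := F) Ω j)
    (Λ : ℝ → Set M) (hΛ : HoferLagrangian.IsExactPath F L Ω Λ)
    (hΛj : ∀ t ∈ Set.Icc (0 : ℝ) 1,
      Λ t ∈ HoferLagrangian.exactClass F L Ω (Set.range j))
    (hreg : HoferLagrangian.IsRegularPath F L Ω Λ)
    (I : Set ℝ) (hI : IsOpen I) (hIconn : I.OrdConnected) (hI0 : (0 : ℝ) ∈ I)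
    (Φ : ℝ → ℝ → L → M) (hΦ : HoferLagrangian.IsExactVariation F L Ω Λ I Φ)
    (l : ℝ → ℝ) (hl : HoferLagrangian.IsLengthFunction Ω I Φ l) :
    ∃ (u : ℝ → ℝ) (δ C : ℝ), ConvexOn ℝ Set.univ u ∧ 0 < δ ∧ 0 < C ∧
      ∀ s : ℝ, |s| < δ → s ∈ I ∧ |l s - u s| ≤ C * s ^ 2 := by
  -- The Hamiltonian is chosen separately for each `s`, with a dummy value outside `I`; no
  -- regularity in `s` is needed.
  have hex : ∀ s : ℝ, ∃ (H : ℝ → M → ℝ) (ψ : ℝ → Diffeomorph 𝓘(ℝ, E) 𝓘(ℝ, E) M M ∞), s ∈ I →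
      IsHamiltonianIsotopy Ω H ψ ∧ (∀ t ∈ Icc (0 : ℝ) 1, ψ t '' range (Φ s 0) = range (Φ s t)) ∧
      l s = ∫ t in (0 : ℝ)..1, (sSup (H t '' range (Φ s t)) - sInf (H t '' range (Φ s t))) := by
    intro s
    by_cases hs : s ∈ I
    · obtain ⟨H, ψ, h⟩ := hl s hs
      exact ⟨H, ψ, fun _ => h⟩
    · exact ⟨fun _ _ => 0, fun _ => Diffeomorph.refl _ _ _, fun h => absurd h hs⟩
  choose H ψ hHψ using hex
  obtain ⟨ε, hε, C, hAff⟩ := exists_almostAffineOn_sub_of_local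
    (k := fun s t x => H s t (Φ s t x)) fun p t₀ ht₀ =>
      exists_almostAffineOn_hamiltonian_local hΩ hI hI0 hΦ.smooth hΦ.lagrangian
        (fun s hs => (hHψ s hs).1) (fun s hs => (hHψ s hs).2.1) p ht₀
  obtain ⟨ρ, hρ, hρI⟩ := Metric.isOpen_iff.1 hI 0 hI0
  have hsub : ∀ s, |s| < min ε ρ → s ∈ I := fun s hs => hρI (by
    rw [Metric.mem_ball, dist_zero_right]
    exact hs.trans_le (min_le_right _ _))
  have hδ : 0 < min ε ρ := lt_min hε hρ
  obtain ⟨u, r, D, hu, hr, hrδ, hD, hle⟩ := exists_convexOn_abs_integral_osc_sub_le_sq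
    (k := fun s t x => H s t (Φ s t x)) (l := l) (C := C) hδ
    (fun s hs => by
      have hsI := hsub s (abs_lt.2 hs)
      refine (hHψ s hsI).1.smooth_hamiltonian.continuousOn.comp
        (f := fun a : ℝ × L => (a.1, Φ s a.1 a.2)) ?_ fun a ha => ⟨ha.1, mem_univ _⟩
      refine continuousOn_fst.prodMk ?_
      exact hΦ.smooth.continuousOn.comp (f := fun a : ℝ × L => (s, a.1, a.2))
        (by fun_prop) fun a ha => ⟨hsI, ha⟩)
    (fun s hs => by
      rw [(hHψ s (hsub s (abs_lt.2 hs))).2.2]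
      simp only [← range_comp]
      rfl)
    (fun t ht x y => (hAff t ht x y).mono
      (Ioo_subset_Ioo (neg_le_neg (min_le_left _ _)) (min_le_left _ _)) le_rfl)
  exact ⟨u, r, D, hu, hr, hD, fun s hs => ⟨hsub s (hs.trans_le hrδ), hle s hs⟩⟩
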